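/- Consider an $n$-player general-sum game in which every player has $d$ actions $\{1,\dots,d\}$. The utilities $\mathcal U_i:\{1,\dots,d\}^n\to\mathbb R$ satisfy $|\mathcal U_i|\le 1$. For mixed strategies $x=(x_1,\dots,x_n)\in(\Delta^d)^n$ let $\nu_i(x)\in\mathbb R^d$ be the reward vector $\nu_i(x)[a]=\mathbb E_{s_{-i}\sim x_{-i}}[\mathcal U_i(a,s_{-i})]$. Suppose the game is $L$-smooth for some $0<L\le 1$, that is, $\|\nu_j(x)-\nu_j(x')\|_\infty\le L\sum_i\|x_i-x_i'\|_1$ for all $j$, $x$, $x'$ (bounded utilities always allow $L=1$). Let $\gamma,\mu>0$, and let each player $i$ have a continuous regularizer $\psi_i:\Delta^d\to\mathbb R$ that is $\mu$-strongly convex with respect to the $\ell_1$ norm and $\gamma$-intrinsically Lipschitz, i.e. $$|\psi_i(x')-\psi_i(x)|^2\le\gamma\,D_{\psi_i}(x'\,\|\,x)\qquad\text{for all }x,x'\in\Delta^d .$$ Here $D_\psi(x'\|x)=\psi(x')-\psi(x)-\langle\nabla\psi(x),x'-x\rangle\in[0,\infty]$ is the Bregman divergence, with the last term read as the one-sided derivative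 of $\psi$ at $x$ in the direction $x'-x$. Put $\Gamma=\gamma/\mu$ and $$\eta_0=\min\Big\{\frac{3\gamma}{80},\ \frac{\mu}{32\sqrt2},\ \frac{\mu}{32\sqrt6\,Ln}\Big\}.$$ A player with regularizer $\psi$ follows COFTRL (Cautious Optimistic Follow-the-Regularized-Leader) with parameters $\eta,\alpha$ if in every round $t=1,2,\dots$ the player computes $$r^{(t)}=u^{(t-1)}+\sum_{\tau=1}^{t-1}u^{(\tau)},\qquad \lambda^{(t)}\in\operatorname*{arg\,max}_{\lambda\in(0,\eta]}\Big\{\alpha\log\lambda+\max_{x\in\Delta^d}\big(\lambda\langle r^{(t)},x\rangle-\psi(x)\big)\Big\},$$ plays $$x^{(t)}\in\operatorname*{arg\,max}_{x\in\Delta^d}\big\{\lambda^{(t)}\langle r^{(t)},x\rangle-\psi(x)\big\},$$ observes the reward vector $\nu^{(t)}$, and sets $u^{(t)}=\nu^{(t)}-\langle\nu^{(t)},x^{(t)}\rangle\mathbf 1$ (with $u^{(0)}=0$). Then for every $K\ge 1$ there is a constant $C>0$ depending only on $K$ with the following property. Suppose all $n$ players follow COFTRL with the same parameters $\alpha,\eta$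 for $T\ge 2$ rounds, where player $i$ uses $\psi_i$, the reward vectors are $\nu_i^{(t)}=\nu_i(x^{(t)})$, and $$4\gamma+\mu\le\alpha\le K(4\gamma+\mu),\qquad \eta_0/K\le\eta\le\eta_0 .$$ Then the empirical distribution of play $\sigma=\frac1T\sum_{t=1}^T x_1^{(t)}\otimes\dots\otimes x_n^{(t)}$ is an $\varepsilon$-approximate coarse correlated equilibrium with $$\varepsilon=C\,\frac{n\,\Gamma\log T}{T},$$ that is, $\mathbb E_{s\sim\sigma}[\mathcal U_i(s)]\ge\mathbb E_{s\sim\sigma}[\mathcal U_i(a,s_{-i})]-\varepsilon$ for every player $i$ and every action $a$. -/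

import Mathlib

open Filter Topology

noncomputable section

namespace COFTRL

/-! ### Finite games -/

/-- `U i s` is the utility of player `i` under the pure profile `s`.
All utilities are bounded by one in absolute value. -/
def BoundedUtilities {n d : ℕ} (U : Fin n → (Fin n → Fin d) → ℝ) : Prop :=
  ∀ i s, |U i s| ≤ 1

/-- The reward vector of player `i` at the mixed profile `p`: its entry at the action `a` is
the expected utility `𝔼_{s₋ᵢ ∼ p₋ᵢ} [U i (a, s₋ᵢ)]`. -/
def rewardVector {n d : ℕ} (U : Fin n → (Fin n → Fin d) → ℝ) (i : Fin n)
    (p : Fin n → Fin d → ℝ) : Fin d → ℝ := fun a =>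
  ∑ s : Fin n → Fin d with s i = a, (∏ j ∈ Finset.univ.erase i, p j (s j)) * U i s

/-- `L`-smoothness of the game, from the `ℓ₁` norms of the strategies to the `ℓ_∞` norm of the
rewards (the norm of `Fin d → ℝ` is the maximum norm). -/
def SmoothGame {n d : ℕ} (U : Fin n → (Fin n → Fin d) → ℝ) (L : ℝ) : Prop :=
  ∀ p q : Fin n → Fin d → ℝ, (∀ i, p i ∈ stdSimplex ℝ (Fin d)) →
    (∀ i, q i ∈ stdSimplex ℝ (Fin d)) → ∀ j,
      ‖rewardVector U j p - rewardVector U j q‖ ≤ L * ∑ i, ∑ k, |p i k - q i k|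

/-- `σ` is an `ε`-approximate coarse correlated equilibrium of the game `U`. -/
def IsApproxCCE {n d : ℕ} (U : Fin n → (Fin n → Fin d) → ℝ) (ε : ℝ)
    (σ : (Fin n → Fin d) → ℝ) : Prop :=
  σ ∈ stdSimplex ℝ (Fin n → Fin d) ∧
    ∀ (i : Fin n) (a : Fin d),
      ∑ s, σ s * U i s ≥ ∑ s, σ s * U i (Function.update s i a) - ε

/-- The empirical distribution of play over the rounds `1, …, T`: the average of the product
distributions of the mixed profiles `x 1, …, x T`. -/
def empiricalPlay {n d : ℕ} (x : ℕ → Fin n → Fin d → ℝ) (T : ℕ) : (Fin n → Fin d) → ℝ :=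
  fun s => (1 / (T : ℝ)) * ∑ t ∈ Finset.Icc 1 T, ∏ i, x t i (s i)

/-! ### Regularizers on the simplex -/

/-- The one-sided directional derivative of `ψ` at `x` in the direction `v`, in `[-∞, ∞]`.
For a convex `ψ` the difference quotients are monotone, so the upper limit is a limit. -/
def dirDeriv {d : ℕ} (ψ : (Fin d → ℝ) → ℝ) (x v : Fin d → ℝ) : EReal :=
  limsup (fun h : ℝ => (((ψ (x + h • v) - ψ x) / h : ℝ) : EReal)) (𝓝[>] 0)

/-- The Bregman divergence `D_ψ(x' ‖ x) = ψ x' - ψ x - ⟨∇ψ x, x' - x⟩`, where the last term is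
read as the directional derivative of `ψ` at `x` in the direction `x' - x`. It is thus defined
for all points of the simplex, and it is `∞` where the derivative is `-∞` (as happens for the
negative entropy, whose divergence is the Kullback–Leibler divergence, at boundary points). -/
def bregman {d : ℕ} (ψ : (Fin d → ℝ) → ℝ) (x' x : Fin d → ℝ) : EReal :=
  ((ψ x' - ψ x : ℝ) : EReal) - dirDeriv ψ x (x' - x)

/-- Where `ψ` is differentiable relative to the simplex, `bregman` is the usual expression in
terms of the derivative. -/
theorem bregman_eq_of_hasFDerivWithinAt {d : ℕ} {ψ : (Fin d → ℝ) → ℝ} {x x' : Fin d → ℝ}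
    {ψ' : (Fin d → ℝ) →L[ℝ] ℝ} (hx : x ∈ stdSimplex ℝ (Fin d))
    (hx' : x' ∈ stdSimplex ℝ (Fin d))
    (h : HasFDerivWithinAt ψ ψ' (stdSimplex ℝ (Fin d)) x) :
    bregman ψ x' x = ((ψ x' - ψ x - ψ' (x' - x) : ℝ) : EReal) := by
  have key : Tendsto (fun h : ℝ => (ψ (x + h • (x' - x)) - ψ x) / h) (𝓝[>] 0)
      (𝓝 (ψ' (x' - x))) := by
    have hl : HasDerivWithinAt (fun h : ℝ => x + h • (x' - x)) (x' - x) (Set.Icc 0 1) 0 := by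
      have := ((hasDerivAt_id (0 : ℝ)).smul_const (x' - x)).const_add x
      simpa using this.hasDerivWithinAt
    have hmaps : Set.MapsTo (fun h : ℝ => x + h • (x' - x)) (Set.Icc 0 1)
        (stdSimplex ℝ (Fin d)) := by
      intro s hs
      exact (convex_stdSimplex ℝ (Fin d)).add_smul_sub_mem hx hx' hs
    have h0 : HasFDerivWithinAt ψ ψ' (stdSimplex ℝ (Fin d)) (x + (0 : ℝ) • (x' - x)) := by
      simpa using h
    have hc := h0.comp_hasDerivWithinAt (0 : ℝ) hl hmaps
    rw [hasDerivWithinAt_iff_tendsto_slope] at hc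
    have hs : Set.Icc (0 : ℝ) 1 \ {0} = Set.Ioc 0 1 := by
      ext s
      simp only [Set.mem_sdiff, Set.mem_Icc, Set.mem_singleton_iff, Set.mem_Ioc]
      constructor
      · rintro ⟨⟨h1, h2⟩, h3⟩
        exact ⟨lt_of_le_of_ne h1 (Ne.symm h3), h2⟩
      · rintro ⟨h1, h2⟩
        exact ⟨⟨h1.le, h2⟩, h1.ne'⟩
    rw [hs, nhdsWithin_Ioc_eq_nhdsGT (zero_lt_one' ℝ)] at hc
    refine hc.congr fun s => ?_
    simp [slope_def_field]
  have hE : dirDeriv ψ x (x' - x) = ((ψ' (x' - x) : ℝ) : EReal) :=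
    ((continuous_coe_real_ereal.tendsto _).comp key).limsup_eq
  rw [bregman, hE, ← EReal.coe_sub]

/-- `ψ` is `γ`-intrinsically Lipschitz on the simplex. -/
def IntrinsicallyLipschitz {d : ℕ} (γ : ℝ) (ψ : (Fin d → ℝ) → ℝ) : Prop :=
  ∀ x' ∈ stdSimplex ℝ (Fin d), ∀ x ∈ stdSimplex ℝ (Fin d),
    (((ψ x' - ψ x) ^ 2 : ℝ) : EReal) ≤ (γ : EReal) * bregman ψ x' x

/-- `ψ` is `μ`-strongly convex on the simplex with respect to the `ℓ₁` norm. -/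
def StronglyConvexL1 {d : ℕ} (μ : ℝ) (ψ : (Fin d → ℝ) → ℝ) : Prop :=
  StrongConvexOn {x : PiLp 1 (fun _ : Fin d => ℝ) | x.ofLp ∈ stdSimplex ℝ (Fin d)} μ
    (fun x => ψ x.ofLp)

/-- The conjugate `ψ*_X (g) = sup_{x ∈ Δ} ⟨g, x⟩ - ψ x` of `ψ` restricted to the simplex. -/
def simplexConjugate {d : ℕ} (ψ : (Fin d → ℝ) → ℝ) (g : Fin d → ℝ) : ℝ :=
  sSup ((fun p : Fin d → ℝ => g ⬝ᵥ p - ψ p) '' stdSimplex ℝ (Fin d))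

/-! ### The algorithm -/

/-- The corrected reward `u t = ν t - ⟨ν t, x t⟩ 𝟏` of round `t ≥ 1`, and `u 0 = 0`. -/
def correctedReward {d : ℕ} (ν x : ℕ → Fin d → ℝ) (t : ℕ) : Fin d → ℝ :=
  if t = 0 then 0 else fun k => ν t k - ν t ⬝ᵥ x t

/-- The optimistic cumulative regret vector `r t = ∑_{τ = 1}^{t - 1} u τ + u (t - 1)`. -/
def optimisticRegret {d : ℕ} (ν x : ℕ → Fin d → ℝ) (t : ℕ) : Fin d → ℝ :=
  ∑ τ ∈ Finset.Ico 1 t, correctedReward ν x τ + correctedReward ν x (t - 1)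

/-- A learner who observes the reward vectors `ν 1, ν 2, …` and plays `x 1, x 2, …` follows
cautious optimistic FTRL, with regularizer `ψ`, maximal learning rate `η` and parameter `α`,
during the rounds `1, …, T`. Here `lr t` is the dynamic learning rate of round `t`. -/
def FollowsCOFTRL {d : ℕ} (ψ : (Fin d → ℝ) → ℝ) (η α : ℝ) (T : ℕ)
    (ν x : ℕ → Fin d → ℝ) : Prop :=
  ∃ lr : ℕ → ℝ, ∀ t ∈ Finset.Icc 1 T,
    (lr t ∈ Set.Ioc 0 η ∧
      IsMaxOn (fun l : ℝ => α * Real.log l + simplexConjugate ψ (l • optimisticRegret ν x t))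
        (Set.Ioc 0 η) (lr t)) ∧
    (x t ∈ stdSimplex ℝ (Fin d) ∧
      IsMaxOn (fun p : Fin d → ℝ => lr t * (optimisticRegret ν x t ⬝ᵥ p) - ψ p)
        (stdSimplex ℝ (Fin d)) (x t))

/-- The learning-rate cap `min {3γ/80, μ/(32√2), μ/(32√6 L n)}`. -/
def rateCap (n : ℕ) (L γ μ : ℝ) : ℝ :=
  min (3 * γ / 80) (min (μ / (32 * √2)) (μ / (32 * √6 * L * n)))

end COFTRL

end

/-! Each round jointly minimizes `objective`: the FTRL loss of a strategy `p` at rate `l`, plus the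
barrier `-α log l`. The heart is `objective_growth`: although the term `l * (r ⬝ᵥ p)` couples rate
and strategy, the objective grows away from the chosen pair. If `a` is the ratio of the rates, `q`
the difference of the regularizer values and `e` the Bregman gap, optimality bounds the increase
below by `α (a - 1 - log a) + (1 - a) q + a e`. Intrinsic Lipschitzness gives `q² ≤ γ e`, so the
part `4γ` of `α` absorbs the cross term; the part `μ` pays for the movement of `l • p`.

Optimistic be-the-leader telescoping then yields `regret_le`: for every comparator pair `(l, p)`,
`l` times the regret against `p` is at most `α log (η / l) + γ + 6 η`, plus `8 η² / μ` times the
squared variation of the rewards, minus `μ / 40` times the squared path length.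

The freedom in `l` replaces nonnegativity of regret. At `l = η / T` the left side is at least `-2 η`
whatever the regret is, at the price `α log T`. Smoothness bounds the variation by the path lengths,
so summing over players bounds the total squared path length by a multiple of `n K γ log T / μ`. At
`l = η` the logarithm disappears, and the path bound gives `η` times each regret `≤ 15 K γ log T`.
Finally `η ≥ μ / (80 n K)`. -/

namespace COFTRL

/-! ### Convexity and oscillation of regularizers on the simplex -/

section Regularizer

variable {d : ℕ} {ψ : (Fin d → ℝ) → ℝ} {μ γ : ℝ} {g x y : Fin d → ℝ}

theorem abs_dotProduct_le (u v : Fin d → ℝ) : |u ⬝ᵥ v| ≤ ‖u‖ * ∑ k, |v k| := by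
  rw [dotProduct, Finset.mul_sum]
  refine (Finset.abs_sum_le_sum_abs _ _).trans (Finset.sum_le_sum fun k _ => ?_)
  rw [abs_mul]
  exact mul_le_mul_of_nonneg_right (norm_le_pi_norm u k) (abs_nonneg _)

theorem sum_abs_of_mem_stdSimplex (hx : x ∈ stdSimplex ℝ (Fin d)) : ∑ k, |x k| = 1 := by
  rw [← hx.2]
  exact Finset.sum_congr rfl fun k _ => abs_of_nonneg (hx.1 k)

theorem sum_abs_sub_le_two (hx : x ∈ stdSimplex ℝ (Fin d)) (hy : y ∈ stdSimplex ℝ (Fin d)) :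
    ∑ k, |x k - y k| ≤ 2 := by
  calc ∑ k, |x k - y k| ≤ ∑ k, (|x k| + |y k|) := Finset.sum_le_sum fun k _ => abs_sub _ _
    _ = 2 := by
      rw [Finset.sum_add_distrib, sum_abs_of_mem_stdSimplex hx, sum_abs_of_mem_stdSimplex hy]
      norm_num

theorem add_smul_sub_eq (x y : Fin d → ℝ) (h : ℝ) :
    x + h • (y - x) = (1 - h) • x + h • y := by
  module

/-- Strong convexity with respect to the `ℓ₁` norm, along a segment. -/
theorem StronglyConvexL1.segment_le (hψ : StronglyConvexL1 μ ψ) (hx : x ∈ stdSimplex ℝ (Fin d))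
    (hy : y ∈ stdSimplex ℝ (Fin d)) {h : ℝ} (h0 : 0 ≤ h) (h1 : h ≤ 1) :
    ψ (x + h • (y - x)) ≤
      (1 - h) * ψ x + h * ψ y - (1 - h) * h * (μ / 2 * (∑ k, |y k - x k|) ^ 2) := by
  have key := hψ.2 (x := WithLp.toLp 1 x) (by simpa using hx) (y := WithLp.toLp 1 y)
    (by simpa using hy) (sub_nonneg.2 h1) h0 (by ring)
  rw [norm_sub_rev, PiLp.norm_eq_of_L1] at key
  rw [add_smul_sub_eq]
  simpa using key

/-- The first-order inequality along a segment issuing from a maximizer of `⟨g, ·⟩ - ψ`. -/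
theorem le_segment_of_isMaxOn
    (hmax : IsMaxOn (fun p => g ⬝ᵥ p - ψ p) (stdSimplex ℝ (Fin d)) x)
    (hx : x ∈ stdSimplex ℝ (Fin d)) (hy : y ∈ stdSimplex ℝ (Fin d)) {h : ℝ}
    (h0 : 0 ≤ h) (h1 : h ≤ 1) :
    h * (g ⬝ᵥ (y - x)) ≤ ψ (x + h • (y - x)) - ψ x := by
  have := hmax ((convex_stdSimplex ℝ (Fin d)).add_smul_sub_mem hx hy ⟨h0, h1⟩)
  simp only [Set.mem_ofPred_eq, dotProduct_add, dotProduct_smul, smul_eq_mul] at this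
  linarith

/-- Quadratic growth at a maximizer of `⟨g, ·⟩ - ψ`. -/
theorem StronglyConvexL1.growth (hψ : StronglyConvexL1 μ ψ)
    (hmax : IsMaxOn (fun p => g ⬝ᵥ p - ψ p) (stdSimplex ℝ (Fin d)) x)
    (hx : x ∈ stdSimplex ℝ (Fin d)) (hy : y ∈ stdSimplex ℝ (Fin d)) :
    μ / 2 * (∑ k, |y k - x k|) ^ 2 ≤ ψ y - ψ x - g ⬝ᵥ (y - x) := by
  set m := μ / 2 * (∑ k, |y k - x k|) ^ 2
  set q := ψ y - ψ x - g ⬝ᵥ (y - x)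
  -- Dividing the segment inequalities by `h` leaves a factor `1 - h`, which tends to `1` as `h →
  -- 0`.
  have key : ∀ h : ℝ, 0 < h → h ≤ 1 → (1 - h) * m ≤ q := by
    intro h h0 h1
    have h2 := hψ.segment_le hx hy h0.le h1
    have h3 := le_segment_of_isMaxOn hmax hx hy h0.le h1
    refine le_of_mul_le_mul_left ?_ h0
    calc h * ((1 - h) * m) = (1 - h) * h * m := by ring
      _ ≤ h * q := by simp only [q, m]; linarith
  have hlim : Tendsto (fun h : ℝ => (1 - h) * m) (𝓝[>] 0) (𝓝 ((1 - 0) * m)) :=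
    ((tendsto_const_nhds.sub tendsto_id).mul_const m).mono_left nhdsWithin_le_nhds
  have := le_of_tendsto hlim (b := q) (by
    filter_upwards [Ioc_mem_nhdsGT (zero_lt_one' ℝ)] with h hh using key h hh.1 hh.2)
  simpa using this

/-- The intrinsic Lipschitz condition at a maximizer of `⟨g, ·⟩ - ψ`. -/
theorem IntrinsicallyLipschitz.sq_le (hψ : IntrinsicallyLipschitz γ ψ) (hγ : 0 ≤ γ)
    (hmax : IsMaxOn (fun p => g ⬝ᵥ p - ψ p) (stdSimplex ℝ (Fin d)) x)
    (hx : x ∈ stdSimplex ℝ (Fin d)) (hy : y ∈ stdSimplex ℝ (Fin d)) :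
    (ψ y - ψ x) ^ 2 ≤ γ * (ψ y - ψ x - g ⬝ᵥ (y - x)) := by
  -- The maximizer may lie on the boundary, so optimality only bounds the directional derivative
  -- from below; this is the direction that bounds the divergence from above.
  have hd : ((g ⬝ᵥ (y - x) : ℝ) : EReal) ≤ dirDeriv ψ x (y - x) := by
    refine le_limsup_of_frequently_le (Eventually.frequently ?_) (by isBoundedDefault)
    filter_upwards [Ioc_mem_nhdsGT (zero_lt_one' ℝ)] with h hh
    rw [EReal.coe_le_coe_iff, le_div_iff₀ hh.1, mul_comm]
    exact le_segment_of_isMaxOn hmax hx hy hh.1.le hh.2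
  have h1 := hψ y hy x hx
  have h2 : (γ : EReal) * bregman ψ y x ≤
      (γ : EReal) * ((ψ y - ψ x - g ⬝ᵥ (y - x) : ℝ) : EReal) := by
    refine mul_le_mul_of_nonneg_left ?_ (by exact_mod_cast hγ)
    rw [EReal.coe_sub]
    exact EReal.sub_le_sub le_rfl hd
  have h3 := h1.trans h2
  rw [← EReal.coe_mul] at h3
  exact_mod_cast h3

/-- A minimizer of `ψ`, put in the form to which the facts about maximizers of `⟨g, ·⟩ - ψ` apply
with `g = 0`. -/
theorem exists_isMinOn_stdSimplex (hc : ContinuousOn ψ (stdSimplex ℝ (Fin d)))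
    (hx : x ∈ stdSimplex ℝ (Fin d)) :
    ∃ z ∈ stdSimplex ℝ (Fin d),
      IsMaxOn (fun p => (0 : Fin d → ℝ) ⬝ᵥ p - ψ p) (stdSimplex ℝ (Fin d)) z := by
  obtain ⟨z, hz, hmin⟩ := (isCompact_stdSimplex ℝ (Fin d)).exists_isMinOn ⟨x, hx⟩ hc
  refine ⟨z, hz, fun p hp => ?_⟩
  have := hmin hp
  simpa using this

/-- The oscillation of a `γ`-intrinsically Lipschitz function is at most `γ`. -/
theorem IntrinsicallyLipschitz.sub_le (hψ : IntrinsicallyLipschitz γ ψ) (hγ : 0 ≤ γ)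
    (hc : ContinuousOn ψ (stdSimplex ℝ (Fin d)))
    (hx : x ∈ stdSimplex ℝ (Fin d)) (hy : y ∈ stdSimplex ℝ (Fin d)) :
    ψ y - ψ x ≤ γ := by
  obtain ⟨z, hz, hmin⟩ := exists_isMinOn_stdSimplex hc hx
  -- At the minimizer `z` this reads `q² ≤ γ q` with `q = ψ y - ψ z`, whence `q ≤ γ`.
  have h1 := hψ.sq_le hγ hmin hz hy
  have h2 : ψ z ≤ ψ x := by have := hmin hx; simpa using this
  simp only [zero_dotProduct, sub_zero] at h1
  nlinarith

/-- Two vertices are at `ℓ₁` distance `2`, so one of them is at distance at least `1` from the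
minimizer. There quadratic growth forces an increase of at least `μ / 2`, while the oscillation is
at most `γ`. -/
theorem le_two_mul_of_regularizer (hd : 2 ≤ d) (hL : IntrinsicallyLipschitz γ ψ) (hγ : 0 ≤ γ)
    (hc : ContinuousOn ψ (stdSimplex ℝ (Fin d))) (hs : StronglyConvexL1 μ ψ) (hμ : 0 < μ) :
    μ ≤ 2 * γ := by
  let i : Fin d := ⟨0, by omega⟩
  let j : Fin d := ⟨1, by omega⟩
  have hij : i ≠ j := by simp [i, j]
  have hi := single_mem_stdSimplex ℝ i
  have hj := single_mem_stdSimplex ℝ j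
  obtain ⟨z, hz, hmin⟩ := exists_isMinOn_stdSimplex hc hi
  have far : ∀ y ∈ stdSimplex ℝ (Fin d), ∑ k, |y k - z k| < 1 ∨ μ ≤ 2 * γ := by
    intro y hy
    by_contra! h
    have h1 := hs.growth hmin hz hy
    have h2 := hL.sub_le hγ hc hz hy
    simp only [zero_dotProduct, sub_zero] at h1
    have h3 : 1 ≤ (∑ k, |y k - z k|) ^ 2 := one_le_pow₀ h.1
    nlinarith [h.2]
  rcases far _ hi with h1 | h1
  · rcases far _ hj with h2 | h2
    · exfalso
      have h3 : (2 : ℝ) ≤ ∑ k, |(Pi.single i (1 : ℝ) : Fin d → ℝ) k - z k|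
          + ∑ k, |(Pi.single j (1 : ℝ) : Fin d → ℝ) k - z k| := by
        rw [← Finset.sum_add_distrib]
        calc (2 : ℝ) = ∑ k ∈ {i, j}, (1 : ℝ) := by
              rw [Finset.sum_pair hij]; norm_num
          _ ≤ ∑ k ∈ {i, j}, (|(Pi.single i (1 : ℝ) : Fin d → ℝ) k - z k|
              + |(Pi.single j (1 : ℝ) : Fin d → ℝ) k - z k|) := by
              refine Finset.sum_le_sum fun k hk => ?_
              rw [Finset.mem_insert, Finset.mem_singleton] at hk
              rcases hk with rfl | rfl
              · rw [Pi.single_eq_same, Pi.single_eq_of_ne hij]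
                have := abs_sub (1 - z i) (0 - z i)
                have e : (1 - z i) - (0 - z i) = 1 := by ring
                rw [e, abs_one] at this
                exact this
              · rw [Pi.single_eq_same, Pi.single_eq_of_ne hij.symm]
                have := abs_sub (1 - z j) (0 - z j)
                have e : (1 - z j) - (0 - z j) = 1 := by ring
                rw [e, abs_one] at this
                linarith
          _ ≤ _ := Finset.sum_le_sum_of_subset_of_nonneg (Finset.subset_univ _)
              fun k _ _ => by positivity
      linarith
    · exact h2
  · exact h1

end Regularizer

/-! ### Scalar inequalities for the growth of the objective -/

section Growth

variable {d : ℕ} {ψ : (Fin d → ℝ) → ℝ} {μ γ α η : ℝ}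

/-- This is `log a ≤ sinh (log a)`, rearranged. -/
theorem sq_div_le_sub_one_sub_log {a : ℝ} (ha : 1 ≤ a) :
    (a - 1) ^ 2 / (2 * a) ≤ a - 1 - Real.log a := by
  have h := Real.self_le_sinh_iff.2 (Real.log_nonneg ha)
  rw [Real.sinh_log (by linarith)] at h
  have e : (a - 1) ^ 2 / (2 * a) = a - 1 - (a - a⁻¹) / 2 := by
    field_simp
    ring
  linarith

/-- This is `log (1 + y) ≥ 2 y / (y + 2)` at `y = a⁻¹ - 1`, rearranged. -/
theorem sq_div_one_add_le_sub_one_sub_log {a : ℝ} (h0 : 0 < a) (ha : a ≤ 1) :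
    (1 - a) ^ 2 / (1 + a) ≤ a - 1 - Real.log a := by
  rcases ha.eq_or_lt with rfl | ha
  · simp
  have h := Real.lt_log_one_add_of_pos (x := a⁻¹ - 1) (by linarith [(one_lt_inv₀ h0).2 ha])
  rw [add_sub_cancel, Real.log_inv] at h
  have e : (1 - a) ^ 2 / (1 + a) = a - 1 + 2 * (a⁻¹ - 1) / (a⁻¹ - 1 + 2) := by
    field_simp
    ring
  linarith

theorem mul_le_sq_div_add_mul_sq {s z : ℝ} (hμ : 0 < μ) :
    z * s ≤ 8 * z ^ 2 / μ + μ * s ^ 2 / 32 := by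
  have h : 0 ≤ (16 * z - μ * s) ^ 2 / (32 * μ) := by positivity
  have e : (16 * z - μ * s) ^ 2 / (32 * μ) = 8 * z ^ 2 / μ + μ * s ^ 2 / 32 - z * s := by
    field_simp
    ring
  linarith

/-- The scalar inequality behind the growth of the objective of the algorithm: `a` is the ratio
of two learning rates, `D` a distance of strategies, `p` a difference of regularizer values, `e`
a Bregman divergence. -/
theorem scalar_growth {a l δ D p e : ℝ} (hμ : 0 < μ) (hγ : 0 < γ) (hα : 4 * γ + μ ≤ α)
    (ha : 0 < a) (hlη : l ≤ η) (halη : a * l ≤ η) (hδ : 0 ≤ δ) (hD : 0 ≤ D)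
    (hD2 : D ≤ 2) (he : μ / 2 * D ^ 2 ≤ e) (hp : p ^ 2 ≤ γ * e) (hpγ : |p| ≤ γ) :
    δ * (l * (min a 1 * D + |a - 1|)) - 8 * (η * δ) ^ 2 / μ + μ / 40 * D ^ 2 ≤
      α * (a - 1 - Real.log a) + (1 - a) * p + a * e := by
  have hα' : (4 * γ + μ) * (a - 1 - Real.log a) ≤ α * (a - 1 - Real.log a) :=
    mul_le_mul_of_nonneg_right hα (by linarith [Real.log_le_sub_one_of_pos ha])
  -- Young's inequality with `z = η δ` eliminates `δ`; `s` bounds the movement measured in units of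
  -- `η`.
  have reduce : ∀ s : ℝ, l * (min a 1 * D + |a - 1|) ≤ η * s →
      μ * s ^ 2 / 32 + μ / 40 * D ^ 2 ≤
        (4 * γ + μ) * (a - 1 - Real.log a) + (1 - a) * p + a * e →
      δ * (l * (min a 1 * D + |a - 1|)) - 8 * (η * δ) ^ 2 / μ + μ / 40 * D ^ 2 ≤
        α * (a - 1 - Real.log a) + (1 - a) * p + a * e := by
    intro s h1 h2
    have h3 := mul_le_sq_div_add_mul_sq (s := s) (z := η * δ) hμ
    have h4 := mul_le_mul_of_nonneg_left h1 hδ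
    linarith
  have hpe : p ^ 2 / γ ≤ e := by
    rw [div_le_iff₀ hγ]
    linarith
  have he0 : 0 ≤ e := le_trans (by positivity) he
  rcases le_or_gt a 1 with ha1 | ha1
  · have hlog := mul_le_mul_of_nonneg_left (sq_div_one_add_le_sub_one_sub_log ha ha1)
      (show 0 ≤ 4 * γ + μ by linarith)
    apply reduce (a * D + (1 - a))
    · rw [min_eq_left ha1, abs_of_nonpos (by linarith), neg_sub]
      exact mul_le_mul_of_nonneg_right hlη
        (add_nonneg (mul_nonneg ha.le hD) (by linarith))
    -- For small `a` the term `a * e` is too weak to complete a square, but `1 - a` is bounded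
    -- below, so the crude bounds `|p| ≤ γ` and `D ≤ 2` suffice. For `a > 1 / 2`, half of `a * e`
    -- completes the square with `(1 - a) * p` and the other half controls `D²`.
    rcases le_or_gt a (1 / 2) with ha2 | ha2
    · have h1 : 2 / 3 * (1 - a) ^ 2 ≤ (1 - a) ^ 2 / (1 + a) := by
        rw [le_div_iff₀ (by linarith)]
        linarith [mul_nonneg (sq_nonneg (1 - a)) (show 0 ≤ 1 - 2 * a by linarith)]
      have h2 := mul_le_mul_of_nonneg_left h1 (show 0 ≤ 4 * γ + μ by linarith)
      have h3 : -((1 - a) * γ) ≤ (1 - a) * p := by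
        linarith [mul_le_mul_of_nonneg_left (abs_le.1 hpγ).1 (show 0 ≤ 1 - a by linarith)]
      have h4 : (1 - a) * γ ≤ 4 * γ * (2 / 3 * (1 - a) ^ 2) := by
        linarith [mul_nonneg (mul_nonneg hγ.le (show 0 ≤ 1 - a by linarith))
          (show 0 ≤ 5 - 8 * a by linarith)]
      have h5 : a * (μ / 2 * D ^ 2) ≤ a * e := mul_le_mul_of_nonneg_left he ha.le
      have h6 : (a * D + (1 - a)) ^ 2 / 32 + 1 / 40 * D ^ 2 ≤
          2 / 3 * (1 - a) ^ 2 + a / 2 * D ^ 2 := by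
        have h0 : 0 ≤ 1 - a := by linarith
        have h7 : (a * D + (1 - a)) ^ 2 ≤ (3 / 2) ^ 2 := by
          have := mul_le_mul_of_nonneg_left hD2 ha.le
          exact pow_le_pow_left₀ (by positivity) (by linarith) 2
        have h8 : D ^ 2 ≤ 4 := by nlinarith
        have h9 : 2 / 3 * (1 / 2) ^ 2 ≤ 2 / 3 * (1 - a) ^ 2 := by
          gcongr
          linarith
        rcases le_or_gt a (1 / 20) with h10 | h10
        · have h11 : 2 / 3 * (19 / 20) ^ 2 ≤ 2 / 3 * (1 - a) ^ 2 := by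
            gcongr
            linarith
          have h12 : 0 ≤ a * D ^ 2 := by positivity
          linarith
        · have h12 : 0 ≤ (a - 1 / 20) * D ^ 2 := mul_nonneg (by linarith) (sq_nonneg D)
          linarith
      have h7 := mul_le_mul_of_nonneg_left h6 hμ.le
      linarith
    · have h1 : 1 / 2 * (1 - a) ^ 2 ≤ (1 - a) ^ 2 / (1 + a) := by
        rw [le_div_iff₀ (by linarith)]
        linarith [mul_nonneg (sq_nonneg (1 - a)) (show 0 ≤ 1 - a by linarith)]
      have h2 := mul_le_mul_of_nonneg_left h1 (show 0 ≤ 4 * γ + μ by linarith)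
      have h3 : 0 ≤ 2 * γ * (1 - a) ^ 2 + (1 - a) * p + a / 2 * e := by
        have h4 : 1 / 4 * (p ^ 2 / γ) ≤ a / 2 * e := by
          have := mul_nonneg (show 0 ≤ a - 1 / 2 by linarith) he0
          linarith
        have h5 : 0 ≤ (p + 2 * γ * (1 - a)) ^ 2 / (4 * γ) + γ * (1 - a) ^ 2 := by positivity
        have h6 : (p + 2 * γ * (1 - a)) ^ 2 / (4 * γ) + γ * (1 - a) ^ 2 =
            2 * γ * (1 - a) ^ 2 + (1 - a) * p + 1 / 4 * (p ^ 2 / γ) := by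
          field_simp
          ring
        linarith
      have h5 : 1 / 4 * (μ / 2 * D ^ 2) ≤ a / 2 * e := by
        have := mul_nonneg (show 0 ≤ a - 1 / 2 by linarith) he0
        linarith
      have h6 : (a * D + (1 - a)) ^ 2 / 32 + 1 / 40 * D ^ 2 ≤
          1 / 2 * (1 - a) ^ 2 + 1 / 8 * D ^ 2 := by
        have h0 : 0 ≤ 1 - a := by linarith
        have h7 : (a * D + (1 - a)) ^ 2 ≤ (D + (1 - a)) ^ 2 := by
          have := mul_le_mul_of_nonneg_right ha1 hD
          exact pow_le_pow_left₀ (by positivity) (by linarith) 2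
        linarith [sq_nonneg (D - (1 - a)), sq_nonneg D, sq_nonneg (1 - a)]
      have h7 := mul_le_mul_of_nonneg_left h6 hμ.le
      linarith
  -- Now `a * l ≤ η` is the sharper constraint: `l * (a - 1) = (a * l) * b ≤ η * b`.
  · obtain ⟨b, hb0, hab⟩ : ∃ b, 0 ≤ b ∧ a - 1 = a * b :=
      ⟨(a - 1) / a, div_nonneg (by linarith) ha.le, by field_simp⟩
    have hlog := mul_le_mul_of_nonneg_left (sq_div_le_sub_one_sub_log ha1.le)
      (show 0 ≤ 4 * γ + μ by linarith)
    have hb : (a - 1) ^ 2 / (2 * a) = a * (b ^ 2 / 2) := by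
      rw [hab]
      field_simp
    rw [hb] at hlog
    apply reduce (D + b)
    · rw [min_eq_right ha1.le, abs_of_pos (by linarith), hab]
      have h1 := mul_le_mul_of_nonneg_right hlη hD
      have h2 := mul_le_mul_of_nonneg_right halη hb0
      linarith
    · have h3 : 0 ≤ a * (2 * γ * b ^ 2 - b * p + e / 2) := by
        refine mul_nonneg ha.le ?_
        have h5 : 0 ≤ (p - 2 * γ * b) ^ 2 / (4 * γ) + p ^ 2 / γ / 4 + γ * b ^ 2 := by positivity
        have h6 : (p - 2 * γ * b) ^ 2 / (4 * γ) + p ^ 2 / γ / 4 + γ * b ^ 2 =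
            2 * γ * b ^ 2 - b * p + p ^ 2 / γ / 2 := by
          field_simp
          ring
        linarith
      have h4 : μ * (b ^ 2 / 2) ≤ a * (μ * (b ^ 2 / 2)) := by
        exact le_mul_of_one_le_left (by positivity) ha1.le
      have h5 : μ / 2 * D ^ 2 / 2 ≤ a * e / 2 := by
        have := mul_nonneg (show 0 ≤ a - 1 by linarith) he0
        linarith
      have h6 : (D + b) ^ 2 / 32 + 1 / 40 * D ^ 2 ≤ 1 / 2 * b ^ 2 + 1 / 4 * D ^ 2 := by
        linarith [sq_nonneg (D - b), sq_nonneg D, sq_nonneg b]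
      have h7 := mul_le_mul_of_nonneg_left h6 hμ.le
      have h8 : (1 - a) * p = -(a * b) * p := by rw [← hab]; ring
      rw [h8]
      linarith

end Growth

/-! ### Growth of the joint objective in learning rate and strategy -/

section Objective

variable {d : ℕ} {ψ : (Fin d → ℝ) → ℝ} {μ γ α η : ℝ}

/-- The loss that a learning rate `l` and a strategy `p` jointly minimize in a round of the
algorithm with optimistic regret vector `r`. -/
noncomputable def objective (ψ : (Fin d → ℝ) → ℝ) (α : ℝ) (r : Fin d → ℝ) (l : ℝ) (p : Fin d → ℝ) : ℝ :=
  ψ p - α * Real.log l - l * (r ⬝ᵥ p)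

theorem simplexConjugate_ge (hc : ContinuousOn ψ (stdSimplex ℝ (Fin d))) (g : Fin d → ℝ)
    {p : Fin d → ℝ} (hp : p ∈ stdSimplex ℝ (Fin d)) :
    g ⬝ᵥ p - ψ p ≤ simplexConjugate ψ g := by
  refine le_csSup ?_ (Set.mem_image_of_mem _ hp)
  refine ((isCompact_stdSimplex ℝ (Fin d)).image_of_continuousOn ?_).bddAbove
  exact ContinuousOn.sub (Continuous.continuousOn (by unfold dotProduct; fun_prop)) hc

theorem simplexConjugate_eq {g x : Fin d → ℝ} (hx : x ∈ stdSimplex ℝ (Fin d))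
    (hmax : IsMaxOn (fun p => g ⬝ᵥ p - ψ p) (stdSimplex ℝ (Fin d)) x) :
    simplexConjugate ψ g = g ⬝ᵥ x - ψ x := by
  refine IsGreatest.csSup_eq ⟨Set.mem_image_of_mem _ hx, ?_⟩
  rintro _ ⟨p, hp, rfl⟩
  exact hmax hp

/-- The change of rate is charged to the strategy with the larger rate, so that the change of
strategy is weighted by the smaller one. -/
theorem sum_abs_smul_sub_smul_le {p x : Fin d → ℝ} (hp : p ∈ stdSimplex ℝ (Fin d))
    (hx : x ∈ stdSimplex ℝ (Fin d)) {a l : ℝ} (ha : 0 ≤ a) (hl : 0 ≤ l) :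
    ∑ k, |a * l * p k - l * x k| ≤ l * (min a 1 * ∑ k, |p k - x k| + |a - 1|) := by
  rcases le_total a 1 with h | h
  · rw [min_eq_left h]
    calc ∑ k, |a * l * p k - l * x k| ≤ ∑ k, (a * l * |p k - x k| + l * |a - 1| * |x k|) := by
          refine Finset.sum_le_sum fun k _ => ?_
          have e : a * l * p k - l * x k = a * l * (p k - x k) + l * (a - 1) * x k := by ring
          rw [e]
          refine (abs_add_le _ _).trans (le_of_eq ?_)
          simp only [abs_mul, abs_of_nonneg ha, abs_of_nonneg hl]
      _ = _ := by
          rw [Finset.sum_add_distrib, ← Finset.mul_sum, ← Finset.mul_sum,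
            sum_abs_of_mem_stdSimplex hx]
          ring
  · rw [min_eq_right h]
    calc ∑ k, |a * l * p k - l * x k| ≤ ∑ k, (l * |p k - x k| + l * |a - 1| * |p k|) := by
          refine Finset.sum_le_sum fun k _ => ?_
          have e : a * l * p k - l * x k = l * (p k - x k) + l * (a - 1) * p k := by ring
          rw [e]
          refine (abs_add_le _ _).trans (le_of_eq ?_)
          simp only [abs_mul, abs_of_nonneg hl]
      _ = _ := by
          rw [Finset.sum_add_distrib, ← Finset.mul_sum, ← Finset.mul_sum,
            sum_abs_of_mem_stdSimplex hp]
          ring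

/-- First-order optimality of `1` for `b ↦ α log b + (b - 1) A` on `(0, B]`, where `1 ≤ B`. -/
theorem first_order_of_log_add_linear_le {A B : ℝ} (hα : 0 ≤ α)
    (hB : 1 ≤ B) (h : ∀ b, 0 < b → b ≤ B → α * Real.log b + (b - 1) * A ≤ 0)
    {a : ℝ} (ha : a ≤ B) : -(α * (1 - a)) ≤ (1 - a) * A := by
  have hlim : ∀ s : Set ℝ, Tendsto (fun b : ℝ => b * A) (𝓝[s] 1) (𝓝 (1 * A)) := fun s =>
    ((continuous_id.mul continuous_const).tendsto 1).mono_left nhdsWithin_le_nhds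
  have key : ∀ b, 0 < b → b ≤ B → (b - 1) * (b * A + α) ≤ 0 := by
    intro b hb hbB
    have h1 := mul_le_mul_of_nonneg_left (Real.one_sub_inv_le_log_of_pos hb) hα
    have h2 : b * (α * (1 - b⁻¹) + (b - 1) * A) ≤ 0 :=
      mul_nonpos_of_nonneg_of_nonpos hb.le (by linarith [h b hb hbB])
    have e : b * (α * (1 - b⁻¹) + (b - 1) * A) = (b - 1) * (b * A + α) := by
      field_simp
      ring
    rwa [e] at h2
  -- Since `1` may be the right endpoint `B`, only the one-sided limit on the side of `a` is used.
  rcases le_or_gt a 1 with h1 | h1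
  · have h2 : -α ≤ 1 * A := by
      refine ge_of_tendsto (hlim (Set.Iio 1)) ?_
      filter_upwards [Ioo_mem_nhdsLT (zero_lt_one' ℝ)] with b hb
      have := key b hb.1 (hb.2.le.trans hB)
      by_contra! hneg
      exact absurd this (not_le.2 (mul_pos_of_neg_of_neg (by linarith [hb.2]) (by linarith)))
    linarith [mul_le_mul_of_nonneg_left h2 (sub_nonneg.2 h1)]
  · have h2 : 1 * A ≤ -α := by
      refine le_of_tendsto (hlim (Set.Ioi 1)) ?_
      filter_upwards [Ioo_mem_nhdsGT h1] with b hb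
      have := key b (by linarith [hb.1]) (hb.2.le.trans ha)
      by_contra! hneg
      exact absurd this (not_le.2 (mul_pos (by linarith [hb.1]) (by linarith)))
    linarith [mul_le_mul_of_nonneg_left h2 (show 0 ≤ a - 1 by linarith)]

/-- Growth of the objective away from the pair chosen by the algorithm. -/
theorem objective_growth (hμ : 0 < μ) (hγ : 0 < γ) (hα : 4 * γ + μ ≤ α)
    (hc : ContinuousOn ψ (stdSimplex ℝ (Fin d))) (hs : StronglyConvexL1 μ ψ)
    (hL : IntrinsicallyLipschitz γ ψ) {r x p : Fin d → ℝ} {lr l δ : ℝ}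
    (hlr : lr ∈ Set.Ioc 0 η)
    (hlrmax : IsMaxOn (fun l : ℝ => α * Real.log l + simplexConjugate ψ (l • r))
      (Set.Ioc 0 η) lr)
    (hx : x ∈ stdSimplex ℝ (Fin d))
    (hxmax : IsMaxOn (fun p : Fin d → ℝ => lr * (r ⬝ᵥ p) - ψ p) (stdSimplex ℝ (Fin d)) x)
    (hl : l ∈ Set.Ioc 0 η) (hp : p ∈ stdSimplex ℝ (Fin d)) (hδ : 0 ≤ δ) :
    objective ψ α r lr x + δ * ∑ k, |l * p k - lr * x k| - 8 * (η * δ) ^ 2 / μ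
        + μ / 40 * (∑ k, |p k - x k|) ^ 2 ≤ objective ψ α r l p := by
  obtain ⟨a, ha, rfl⟩ : ∃ a, 0 < a ∧ l = a * lr :=
    ⟨l / lr, div_pos hl.1 hlr.1, by field_simp [hlr.1.ne']⟩
  have hlr0 := hlr.1
  have hmax : IsMaxOn (fun p => (lr • r) ⬝ᵥ p - ψ p) (stdSimplex ℝ (Fin d)) x := by
    simpa only [smul_dotProduct, smul_eq_mul] using hxmax
  -- The rate `b * lr` is tested with `x` kept fixed: the conjugate is attained at `x` for the rate
  -- `lr` and is bounded below by the value at `x` for all other rates.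
  have hA := first_order_of_log_add_linear_le (α := α) (A := lr * (r ⬝ᵥ x)) (B := η / lr)
    (by linarith) ((one_le_div hlr0).2 hlr.2) (fun b hb hbη => by
      have h1 := hlrmax (show b * lr ∈ Set.Ioc 0 η from
        ⟨mul_pos hb hlr0, (le_div_iff₀ hlr0).1 hbη⟩)
      have h2 := simplexConjugate_ge hc ((b * lr) • r) hx
      simp only [Set.mem_ofPred_eq, simplexConjugate_eq hx hmax, smul_dotProduct, smul_eq_mul,
        Real.log_mul hb.ne' hlr0.ne'] at h1 h2
      linarith) (a := a) ((le_div_iff₀ hlr0).2 hl.2)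
  have he := hs.growth hmax hx hp
  have hpe := hL.sq_le hγ.le hmax hx hp
  have hpγ : |ψ p - ψ x| ≤ γ :=
    abs_sub_le_iff.2 ⟨hL.sub_le hγ.le hc hx hp, hL.sub_le hγ.le hc hp hx⟩
  have h1 := scalar_growth hμ hγ hα ha hlr.2 hl.2 hδ
    (Finset.sum_nonneg fun k _ => abs_nonneg (p k - x k)) (sum_abs_sub_le_two hp hx) he hpe hpγ
  have h2 := mul_le_mul_of_nonneg_left (sum_abs_smul_sub_smul_le hp hx ha.le hlr0.le) hδ
  simp only [objective, Real.log_mul ha.ne' hlr0.ne']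
  simp only [smul_dotProduct, dotProduct_sub, smul_eq_mul] at h1
  linarith

end Objective

/-! ### Regret bounded by variation in utilities -/

section Regret

variable {d : ℕ} {ψ : (Fin d → ℝ) → ℝ} {μ γ α η : ℝ} {T : ℕ} {ν x : ℕ → Fin d → ℝ}

/-- The change of the corrected reward in round `t`. -/
noncomputable def rewardChange (ν x : ℕ → Fin d → ℝ) (t : ℕ) : ℝ :=
  ‖correctedReward ν x t - correctedReward ν x (t - 1)‖

/-- The `ℓ₁` distance between the strategies of the rounds `t` and `t + 1`. -/
noncomputable def stepLength (x : ℕ → Fin d → ℝ) (t : ℕ) : ℝ := ∑ k, |x (t + 1) k - x t k|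

theorem correctedReward_zero : correctedReward ν x 0 = 0 := by simp [correctedReward]

theorem correctedReward_dotProduct {t : ℕ} (ht : t ≠ 0) {p : Fin d → ℝ}
    (hp : p ∈ stdSimplex ℝ (Fin d)) :
    correctedReward ν x t ⬝ᵥ p = ν t ⬝ᵥ p - ν t ⬝ᵥ x t := by
  simp only [correctedReward, if_neg ht, dotProduct, sub_mul, Finset.sum_sub_distrib,
    ← Finset.mul_sum, hp.2, mul_one]

theorem abs_dotProduct_le_one {v p : Fin d → ℝ} (hv : ‖v‖ ≤ 1)
    (hp : p ∈ stdSimplex ℝ (Fin d)) : |v ⬝ᵥ p| ≤ 1 := by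
  have := abs_dotProduct_le v p
  rw [sum_abs_of_mem_stdSimplex hp] at this
  linarith

theorem abs_correctedReward_dotProduct_le {t : ℕ} (ht : t ∈ Finset.Icc 1 T)
    (hν : ∀ t ∈ Finset.Icc 1 T, ‖ν t‖ ≤ 1)
    (hx : ∀ t ∈ Finset.Icc 1 T, x t ∈ stdSimplex ℝ (Fin d)) {p : Fin d → ℝ}
    (hp : p ∈ stdSimplex ℝ (Fin d)) : |correctedReward ν x t ⬝ᵥ p| ≤ 2 := by
  rw [correctedReward_dotProduct (by have := Finset.mem_Icc.1 ht; omega) hp]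
  linarith [abs_sub (ν t ⬝ᵥ p) (ν t ⬝ᵥ x t), abs_dotProduct_le_one (hν t ht) hp,
    abs_dotProduct_le_one (hν t ht) (hx t ht)]

theorem optimisticRegret_one : optimisticRegret ν x 1 = 0 := by
  simp [optimisticRegret, correctedReward_zero]

theorem optimisticRegret_succ {t : ℕ} (ht : 1 ≤ t) :
    optimisticRegret ν x (t + 1) = optimisticRegret ν x t
      + (correctedReward ν x t - correctedReward ν x (t - 1)) + correctedReward ν x t := by
  rw [optimisticRegret, optimisticRegret, Finset.sum_Ico_succ_top ht, add_tsub_cancel_right]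
  abel

theorem objective_add (r v p : Fin d → ℝ) (l : ℝ) :
    objective ψ α (r + v) l p = objective ψ α r l p - l * (v ⬝ᵥ p) := by
  simp only [objective, add_dotProduct]
  ring

theorem sum_correctedReward {T : ℕ} (hT : 1 ≤ T) :
    ∑ t ∈ Finset.Icc 1 T, correctedReward ν x t = optimisticRegret ν x T
      + (correctedReward ν x T - correctedReward ν x (T - 1)) := by
  rw [← Finset.Ico_add_one_right_eq_Icc, Finset.sum_Ico_succ_top hT, optimisticRegret]
  abel

/-- The regret bound by variation in utilities of cautious optimistic FTRL. -/
theorem regret_le (hμ : 0 < μ) (hγ : 0 < γ) (hα : 4 * γ + μ ≤ α)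
    (hc : ContinuousOn ψ (stdSimplex ℝ (Fin d))) (hs : StronglyConvexL1 μ ψ)
    (hL : IntrinsicallyLipschitz γ ψ) (hT : 1 ≤ T) (hν : ∀ t ∈ Finset.Icc 1 T, ‖ν t‖ ≤ 1)
    (hF : FollowsCOFTRL ψ η α T ν x) {l : ℝ} (hl : l ∈ Set.Ioc 0 η) {p : Fin d → ℝ}
    (hp : p ∈ stdSimplex ℝ (Fin d)) :
    l * ((∑ t ∈ Finset.Icc 1 T, correctedReward ν x t) ⬝ᵥ p) ≤
      α * Real.log (η / l) + γ + 6 * η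
        + 8 * η ^ 2 / μ * ∑ t ∈ Finset.Ico 1 T, rewardChange ν x t ^ 2
        - μ / 40 * ∑ t ∈ Finset.Ico 1 T, stepLength x t ^ 2 := by
  obtain ⟨lr, h⟩ := hF
  have hx : ∀ t ∈ Finset.Icc 1 T, x t ∈ stdSimplex ℝ (Fin d) := fun t ht => (h t ht).2.1
  have growth : ∀ t ∈ Finset.Icc 1 T, ∀ l ∈ Set.Ioc 0 η, ∀ p ∈ stdSimplex ℝ (Fin d), ∀ δ : ℝ, 0 ≤ δ →
      _ := fun t ht l hl p hp δ hδ => objective_growth hμ hγ hα hc hs hL (h t ht).1.1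
        (h t ht).1.2 (h t ht).2.1 (h t ht).2.2 hl hp hδ
  have hη : 0 < η := hl.1.trans_le hl.2
  -- The added term removes the optimistic guess: the right side is the objective of the played pair
  -- for the true cumulative regret `∑ τ < t, u τ`.
  have main : ∀ t, 1 ≤ t → t ≤ T →
      objective ψ α (optimisticRegret ν x 1) (lr 1) (x 1)
        - 8 * η ^ 2 / μ * ∑ τ ∈ Finset.Ico 1 t, rewardChange ν x τ ^ 2
        + μ / 40 * ∑ τ ∈ Finset.Ico 1 t, stepLength x τ ^ 2 ≤
      objective ψ α (optimisticRegret ν x t) (lr t) (x t)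
        + lr t * (correctedReward ν x (t - 1) ⬝ᵥ x t) := by
    intro t ht
    induction t, ht using Nat.le_induction with
    | base => intro _; simp [correctedReward_zero]
    | succ t ht ih =>
      intro htT
      have htm : t ∈ Finset.Icc 1 T := Finset.mem_Icc.2 ⟨ht, by omega⟩
      have htm' : t + 1 ∈ Finset.Icc 1 T := Finset.mem_Icc.2 ⟨by omega, htT⟩
      have h1 := growth t htm _ (h _ htm').1.1 _ (hx _ htm') (rewardChange ν x t)
        (norm_nonneg _)
      have h2 := abs_dotProduct_le (correctedReward ν x t - correctedReward ν x (t - 1))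
        (lr (t + 1) • x (t + 1) - lr t • x t)
      have h3 := ih (by omega)
      -- This orthogonality lets `-u (t - 1)` be replaced by `u t - u (t - 1)` when paired with `lr
      -- t • x t`, so only the change of `lr • x` meets the change of rewards.
      have h4 : correctedReward ν x t ⬝ᵥ x t = 0 := by
        rw [correctedReward_dotProduct (by omega) (hx t htm), sub_self]
      rw [Finset.sum_Ico_succ_top ht, Finset.sum_Ico_succ_top ht, optimisticRegret_succ ht,
        objective_add, objective_add, add_tsub_cancel_right]
      have h5 := (abs_le.1 h2).2
      simp only [dotProduct_sub, dotProduct_smul, sub_dotProduct, smul_eq_mul, Pi.sub_apply,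
        Pi.smul_apply, h4] at h5 ⊢
      have h6 : 8 * (η * rewardChange ν x t) ^ 2 / μ
        = 8 * η ^ 2 / μ * rewardChange ν x t ^ 2 := by ring
      rw [h6] at h1
      simp only [rewardChange, stepLength] at h1 h3 ⊢
      linarith
  have h1m : 1 ∈ Finset.Icc 1 T := Finset.mem_Icc.2 ⟨le_rfl, hT⟩
  have hTm : T ∈ Finset.Icc 1 T := Finset.mem_Icc.2 ⟨hT, le_rfl⟩
  have small : ∀ t, t ≤ T → ∀ p ∈ stdSimplex ℝ (Fin d), ∀ l ∈ Set.Ioc 0 η,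
      |l * (correctedReward ν x t ⬝ᵥ p)| ≤ 2 * η := by
    intro t ht p hp l hl
    rcases Nat.eq_zero_or_pos t with rfl | h0
    · simp [correctedReward_zero, hη.le]
    rw [abs_mul, abs_of_pos hl.1, mul_comm]
    exact mul_le_mul (abs_correctedReward_dotProduct_le (Finset.mem_Icc.2 ⟨h0, ht⟩) hν hx hp)
      hl.2 hl.1.le zero_le_two
  have h2 := growth T hTm l hl p hp 0 le_rfl
  have h3 := main T hT le_rfl
  -- The three boundary terms, each at most `2 * η`, make up the `6 * η`.
  have h4 := (abs_le.1 (small (T - 1) (by omega) _ (hx T hTm) _ (h T hTm).1.1)).2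
  have h5 := (abs_le.1 (small (T - 1) (by omega) p hp l hl)).1
  have h6 := (abs_le.1 (small T le_rfl p hp l hl)).2
  have h7 : α * Real.log (lr 1) ≤ α * Real.log η :=
    mul_le_mul_of_nonneg_left (Real.log_le_log (h 1 h1m).1.1.1 (h 1 h1m).1.1.2) (by linarith)
  have h8 := hL.sub_le hγ.le hc (hx 1 h1m) hp
  have h9 : 0 ≤ μ / 40 * (∑ k, |p k - x T k|) ^ 2 := by positivity
  rw [sum_correctedReward hT, add_dotProduct, sub_dotProduct, Real.log_div hη.ne' hl.1.ne']
  simp only [optimisticRegret_one] at h3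
  simp only [objective, zero_dotProduct] at h2 h3
  simp only [mul_zero, zero_mul, zero_pow two_ne_zero, zero_div] at h2 h3
  linarith

end Regret

/-! ### Expected utilities, equilibria and variation of rewards -/

section Game

variable {n d : ℕ} {U : Fin n → (Fin n → Fin d) → ℝ} {p : Fin n → Fin d → ℝ}

/-- The expected utility under independent play is `⟨p i, ν i⟩`. -/
theorem sum_prod_mul_eq (U : Fin n → (Fin n → Fin d) → ℝ) (p : Fin n → Fin d → ℝ) (i : Fin n) :
    ∑ s : Fin n → Fin d, (∏ j, p j (s j)) * U i s = rewardVector U i p ⬝ᵥ p i := by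
  rw [← Finset.sum_fiberwise_of_maps_to (s := Finset.univ) (t := Finset.univ)
    (g := fun s : Fin n → Fin d => s i) (fun _ _ => Finset.mem_univ _), dotProduct]
  refine Finset.sum_congr rfl fun a _ => ?_
  rw [rewardVector, Finset.sum_mul]
  refine Finset.sum_congr rfl fun s hs => ?_
  rw [← Finset.mul_prod_erase _ _ (Finset.mem_univ i), (Finset.mem_filter.1 hs).2]
  ring

/-- With the own action overwritten by `a`, the own coordinate has no effect; this makes the
deviation payoff independent of `p i`. -/
theorem rewardVector_update (U : Fin n → (Fin n → Fin d) → ℝ) (p : Fin n → Fin d → ℝ)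
    (i : Fin n) (a b : Fin d) :
    rewardVector (fun i s => U i (Function.update s i a)) i p b = rewardVector U i p a := by
  refine Finset.sum_nbij' (fun s => Function.update s i a) (fun s => Function.update s i b)
    ?_ ?_ ?_ ?_ ?_
  · simp
  · simp
  · intro s hs
    simp only [Finset.mem_filter] at hs
    simp [← hs.2]
  · intro s hs
    simp only [Finset.mem_filter] at hs
    simp [← hs.2]
  · intro s _
    congr 1
    refine Finset.prod_congr rfl fun j hj => ?_
    rw [Function.update_of_ne (Finset.ne_of_mem_erase hj)]

/-- The expected utility of the deviation to the action `a`. -/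
theorem sum_prod_mul_update_eq (hp : ∀ i, p i ∈ stdSimplex ℝ (Fin d)) (i : Fin n) (a : Fin d) :
    ∑ s : Fin n → Fin d, (∏ j, p j (s j)) * U i (Function.update s i a) =
      rewardVector U i p a := by
  rw [sum_prod_mul_eq (fun i s => U i (Function.update s i a)) p i, dotProduct]
  simp only [rewardVector_update, ← Finset.mul_sum, (hp i).2, mul_one]

theorem sum_prod_eq_one (hp : ∀ i, p i ∈ stdSimplex ℝ (Fin d)) :
    ∑ s : Fin n → Fin d, ∏ j, p j (s j) = 1 := by
  rw [← Fintype.piFinset_univ, Finset.sum_prod_piFinset]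
  exact Finset.prod_eq_one fun j _ => (hp j).2

theorem norm_rewardVector_le (hU : BoundedUtilities U) (hp : ∀ i, p i ∈ stdSimplex ℝ (Fin d))
    (i : Fin n) : ‖rewardVector U i p‖ ≤ 1 := by
  refine (pi_norm_le_iff_of_nonneg zero_le_one).2 fun a => ?_
  rw [Real.norm_eq_abs, ← sum_prod_mul_update_eq hp, ← sum_prod_eq_one hp]
  refine (Finset.abs_sum_le_sum_abs _ _).trans (Finset.sum_le_sum fun s _ => ?_)
  have h0 : 0 ≤ ∏ j, p j (s j) := Finset.prod_nonneg fun j _ => (hp j).1 _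
  rw [abs_mul, abs_of_nonneg h0]
  exact mul_le_of_le_one_right h0 (hU i _)

variable {x : ℕ → Fin n → Fin d → ℝ} {T : ℕ}

theorem empiricalPlay_mem_stdSimplex (hT : 1 ≤ T)
    (hx : ∀ t ∈ Finset.Icc 1 T, ∀ i, x t i ∈ stdSimplex ℝ (Fin d)) :
    empiricalPlay x T ∈ stdSimplex ℝ (Fin n → Fin d) := by
  constructor
  · intro s
    exact mul_nonneg (by positivity) (Finset.sum_nonneg fun t ht =>
      Finset.prod_nonneg fun j _ => (hx t ht j).1 _)
  · simp only [empiricalPlay]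
    rw [← Finset.mul_sum, Finset.sum_comm, Finset.sum_congr rfl fun t ht =>
      sum_prod_eq_one (hx t ht)]
    have : (T : ℝ) ≠ 0 := by positivity
    simp [this]

theorem sum_empiricalPlay_mul (x : ℕ → Fin n → Fin d → ℝ) (T : ℕ) (f : (Fin n → Fin d) → ℝ) :
    ∑ s, empiricalPlay x T s * f s =
      1 / (T : ℝ) * ∑ t ∈ Finset.Icc 1 T, ∑ s : Fin n → Fin d, (∏ i, x t i (s i)) * f s := by
  simp only [empiricalPlay]
  rw [Finset.sum_comm, Finset.mul_sum]
  simp only [Finset.sum_mul, Finset.mul_sum, mul_assoc]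

/-- Players whose regret is at most `ε T` are in an `ε`-approximate coarse correlated
equilibrium on average. -/
theorem isApproxCCE_of_regret_le {ε : ℝ} (hT : 1 ≤ T)
    (hx : ∀ t ∈ Finset.Icc 1 T, ∀ i, x t i ∈ stdSimplex ℝ (Fin d))
    (h : ∀ i a, (∑ t ∈ Finset.Icc 1 T, correctedReward (fun t => rewardVector U i (x t))
      (fun t => x t i) t) a ≤ T * ε) : IsApproxCCE U ε (empiricalPlay x T) := by
  refine ⟨empiricalPlay_mem_stdSimplex hT hx, fun i a => ?_⟩
  have hT0 : (0 : ℝ) < T := by exact_mod_cast hT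
  have e : (∑ t ∈ Finset.Icc 1 T, correctedReward (fun t => rewardVector U i (x t))
      (fun t => x t i) t) a =
      ∑ t ∈ Finset.Icc 1 T, rewardVector U i (x t) a
        - ∑ t ∈ Finset.Icc 1 T, rewardVector U i (x t) ⬝ᵥ x t i := by
    rw [Finset.sum_apply, ← Finset.sum_sub_distrib]
    refine Finset.sum_congr rfl fun t ht => ?_
    rw [correctedReward, if_neg (by have := Finset.mem_Icc.1 ht; omega)]
  have h1 := h i a
  rw [e] at h1
  rw [sum_empiricalPlay_mul, sum_empiricalPlay_mul,
    Finset.sum_congr rfl fun t ht => sum_prod_mul_update_eq (U := U) (hx t ht) i a,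
    Finset.sum_congr rfl fun t ht => sum_prod_mul_eq U (x t) i, ge_iff_le, sub_le_iff_le_add,
    ← sub_le_iff_le_add', ← mul_sub, one_div, inv_mul_le_iff₀ hT0]
  exact h1

/-- The variation of the corrected rewards in terms of the variation of the strategies. -/
theorem rewardChange_sq_le {L : ℝ} (hU : BoundedUtilities U) (hs : SmoothGame U L)
    {t : ℕ} (ht : 1 ≤ t) (hx : ∀ i, x t i ∈ stdSimplex ℝ (Fin d))
    (hx' : ∀ i, x (t + 1) i ∈ stdSimplex ℝ (Fin d)) (i : Fin n) :
    rewardChange (fun t => rewardVector U i (x t)) (fun t => x t i) (t + 1) ^ 2 ≤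
      8 * L ^ 2 * n * ∑ j, stepLength (fun t => x t j) t ^ 2
        + 2 * stepLength (fun t => x t i) t ^ 2 := by
  set N := ‖rewardVector U i (x (t + 1)) - rewardVector U i (x t)‖
  have hN : N ≤ L * ∑ j, stepLength (fun t => x t j) t := hs _ _ hx' hx i
  have hD : 0 ≤ stepLength (fun t => x t i) t := Finset.sum_nonneg fun k _ => abs_nonneg _
  -- The change is `Δν - ⟨Δν, x (t + 1)⟩ 𝟏 - ⟨ν t, Δx⟩ 𝟏`; the first two terms cost `N` each and the
  -- last one costs the step length.
  have h1 : rewardChange (fun t => rewardVector U i (x t)) (fun t => x t i) (t + 1) ≤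
      2 * N + stepLength (fun t => x t i) t := by
    refine (pi_norm_le_iff_of_nonneg (by positivity)).2 fun k => ?_
    have h2 : |(rewardVector U i (x (t + 1)) - rewardVector U i (x t)) k| ≤ N :=
      norm_le_pi_norm (rewardVector U i (x (t + 1)) - rewardVector U i (x t)) k
    have h3 := abs_dotProduct_le (rewardVector U i (x (t + 1)) - rewardVector U i (x t))
      (x (t + 1) i)
    rw [sum_abs_of_mem_stdSimplex (hx' i)] at h3
    have h4 := abs_dotProduct_le (rewardVector U i (x t)) (x (t + 1) i - x t i)
    have h5 := mul_le_mul_of_nonneg_right (norm_rewardVector_le hU hx i) hD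
    simp only [correctedReward, Pi.sub_apply, Real.norm_eq_abs, add_tsub_cancel_right,
      Nat.add_eq_zero_iff, one_ne_zero, and_false, if_false, if_neg (show t ≠ 0 by omega)]
    simp only [sub_dotProduct, dotProduct_sub, Pi.sub_apply] at h2 h3 h4
    have h6 : |rewardVector U i (x t) ⬝ᵥ x (t + 1) i - rewardVector U i (x t) ⬝ᵥ x t i| ≤
        stepLength (fun t => x t i) t := by
      refine h4.trans (h5.trans (by rw [one_mul]))
    rw [abs_le] at h2 h3 h6 ⊢
    constructor <;> linarith
  have h7 : N ^ 2 ≤ L ^ 2 * (n * ∑ j, stepLength (fun t => x t j) t ^ 2) := by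
    calc N ^ 2 ≤ (L * ∑ j, stepLength (fun t => x t j) t) ^ 2 :=
          pow_le_pow_left₀ (norm_nonneg _) hN 2
      _ = L ^ 2 * (∑ j, stepLength (fun t => x t j) t) ^ 2 := mul_pow _ _ _
      _ ≤ _ := by
        refine mul_le_mul_of_nonneg_left ?_ (sq_nonneg L)
        have := sq_sum_le_card_mul_sum_sq (s := Finset.univ)
          (f := fun j : Fin n => stepLength (fun t => x t j) t)
        simpa using this
  calc _ ≤ (2 * N + stepLength (fun t => x t i) t) ^ 2 := pow_le_pow_left₀ (norm_nonneg _) h1 2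
    _ ≤ 8 * N ^ 2 + 2 * stepLength (fun t => x t i) t ^ 2 := by
      linarith [sq_nonneg (2 * N - stepLength (fun t => x t i) t)]
    _ ≤ _ := by linarith

/-- The change in round `t + 1` is charged to the step from `t` to `t + 1`. Round `1` has no
preceding step: since `u 0 = 0`, it contributes at most `2² = 4`. -/
theorem sum_rewardChange_sq_le {L : ℝ} (hU : BoundedUtilities U)
    (hs : SmoothGame U L) (hT : 2 ≤ T)
    (hx : ∀ t ∈ Finset.Icc 1 T, ∀ i, x t i ∈ stdSimplex ℝ (Fin d)) (i : Fin n) :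
    ∑ t ∈ Finset.Ico 1 T,
        rewardChange (fun t => rewardVector U i (x t)) (fun t => x t i) t ^ 2 ≤
      4 + 8 * L ^ 2 * n * ∑ j, ∑ t ∈ Finset.Ico 1 T, stepLength (fun t => x t j) t ^ 2
        + 2 * ∑ t ∈ Finset.Ico 1 T, stepLength (fun t => x t i) t ^ 2 := by
  have h1m : 1 ∈ Finset.Icc 1 T := Finset.mem_Icc.2 ⟨le_rfl, by omega⟩
  have h1 : rewardChange (fun t => rewardVector U i (x t)) (fun t => x t i) 1 ^ 2 ≤ 4 := by
    have h2 : rewardChange (fun t => rewardVector U i (x t)) (fun t => x t i) 1 ≤ 2 := by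
      refine (pi_norm_le_iff_of_nonneg zero_le_two).2 fun k => ?_
      have h3 := abs_correctedReward_dotProduct_le (T := T)
        (ν := fun t => rewardVector U i (x t)) (x := fun t => x t i) h1m
        (fun t ht => norm_rewardVector_le hU (hx t ht) i) (fun t ht => hx t ht i)
        (single_mem_stdSimplex ℝ k)
      simpa [correctedReward_zero] using h3
    calc _ ≤ (2 : ℝ) ^ 2 := pow_le_pow_left₀ (norm_nonneg _) h2 2
      _ = 4 := by norm_num
  obtain ⟨S, rfl⟩ : ∃ S, T = S + 1 := ⟨T - 1, by omega⟩
  rw [Finset.sum_eq_sum_Ico_succ_bot (by omega), ← Finset.sum_Ico_add' _ 1 S 1]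
  have h2 : ∑ t ∈ Finset.Ico 1 S,
        rewardChange (fun t => rewardVector U i (x t)) (fun t => x t i) (t + 1) ^ 2 ≤
      ∑ t ∈ Finset.Ico 1 S, (8 * L ^ 2 * n * ∑ j, stepLength (fun t => x t j) t ^ 2
        + 2 * stepLength (fun t => x t i) t ^ 2) := by
    refine Finset.sum_le_sum fun t ht => ?_
    rw [Finset.mem_Ico] at ht
    exact rewardChange_sq_le hU hs ht.1 (hx t (Finset.mem_Icc.2 ⟨ht.1, by omega⟩))
      (hx (t + 1) (Finset.mem_Icc.2 ⟨by omega, by omega⟩)) i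
  have h3 : ∑ t ∈ Finset.Ico 1 S, (8 * L ^ 2 * n * ∑ j, stepLength (fun t => x t j) t ^ 2
        + 2 * stepLength (fun t => x t i) t ^ 2) ≤
      ∑ t ∈ Finset.Ico 1 (S + 1), (8 * L ^ 2 * n * ∑ j, stepLength (fun t => x t j) t ^ 2
        + 2 * stepLength (fun t => x t i) t ^ 2) :=
    Finset.sum_le_sum_of_subset_of_nonneg
      (Finset.Ico_subset_Ico_right (Nat.le_succ S)) fun t _ _ => by positivity
  rw [Finset.sum_add_distrib (s := Finset.Ico 1 (S + 1)), ← Finset.mul_sum, ← Finset.mul_sum,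
    Finset.sum_comm] at h3
  linarith

end Game

/-! ### Bounds on the learning-rate cap -/

section Constants

theorem rateCap_bounds {n : ℕ} {L γ μ η : ℝ} (hn : 0 < n) (hL : 0 < L)
    (hη0 : 0 ≤ η) (hη : η ≤ rateCap n L γ μ) :
    η ≤ 3 * γ / 80 ∧ 2048 * η ^ 2 ≤ μ ^ 2 ∧ 6144 * (η * L * n) ^ 2 ≤ μ ^ 2 := by
  have hn' : (0 : ℝ) < n := by exact_mod_cast hn
  have h2 := Real.sq_sqrt (show (0 : ℝ) ≤ 2 by norm_num)
  have h6 := Real.sq_sqrt (show (0 : ℝ) ≤ 6 by norm_num)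
  simp only [rateCap, le_min_iff] at hη
  obtain ⟨h, h', h''⟩ := hη
  rw [le_div_iff₀ (by positivity)] at h' h''
  have h3 := pow_le_pow_left₀ (by positivity) h' 2
  have h4 := pow_le_pow_left₀ (by positivity) h'' 2
  refine ⟨h, ?_, ?_⟩
  · calc _ = (η * (32 * √2)) ^ 2 := by rw [mul_pow, mul_pow 32, h2]; ring
      _ ≤ _ := h3
  · calc _ = (η * (32 * √6 * L * n)) ^ 2 := by
          linear_combination (-1024 * (η * L * n) ^ 2) * h6
      _ ≤ _ := h4

/-- The source of the factors `n` and `1 / μ` in the final rate; `μ ≤ 2 * γ` keeps the cap `3γ/80`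
from being the bottleneck. -/
theorem le_rateCap {n : ℕ} {L γ μ : ℝ} (hn : 0 < n) (hL : 0 < L) (hL1 : L ≤ 1) (hμ : 0 < μ)
    (hγ : μ ≤ 2 * γ) : μ / (80 * n) ≤ rateCap n L γ μ := by
  have hn' : (1 : ℝ) ≤ n := by exact_mod_cast hn
  have h2 : √2 ≤ 3 / 2 := Real.sqrt_le_iff.2 ⟨by norm_num, by norm_num⟩
  have h6 : √6 ≤ 5 / 2 := Real.sqrt_le_iff.2 ⟨by norm_num, by norm_num⟩
  refine le_min ?_ (le_min ?_ ?_)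
  · calc μ / (80 * n) ≤ μ / 80 := by gcongr; linarith
      _ ≤ _ := by linarith
  · refine div_le_div_of_nonneg_left hμ.le (by positivity) ?_
    linarith
  · gcongr
    calc 32 * √6 * L ≤ 32 * (5 / 2) * 1 := by gcongr
      _ = 80 := by norm_num

end Constants

/-! ### From path lengths to individual regret -/

section Main

theorem correctedReward_eq_zero_of_subsingleton {d : ℕ} [Subsingleton (Fin d)]
    {ν x : ℕ → Fin d → ℝ} {t : ℕ} (hx : x t ∈ stdSimplex ℝ (Fin d)) :
    correctedReward ν x t = 0 := by
  funext a
  have := Unique.mk' (Fin d) (h₁ := ⟨a⟩)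
  have h1 : x t a = 1 := by
    have := hx.2
    rwa [Fintype.sum_subsingleton _ a] at this
  rw [correctedReward]
  split_ifs
  · rfl
  · rw [dotProduct, Fintype.sum_subsingleton _ a, h1]
    simp

/-- The arithmetic that turns the regret bounds of the `n` players at the learning rates `η / T`
and `η` into a bound on every single regret: `S i` is the squared path length of player `i`,
`V i` the variation of the rewards, and `R` the regret of a player. -/
theorem regret_le_of_path_bounds {n : ℕ} {L γ μ α η K Λ : ℝ} (hn : 0 < n) (hμ : 0 < μ)
    (hγμ : μ ≤ 2 * γ) (hη : 0 < η) (hK : 1 ≤ K) (hΛ : 0.69 ≤ Λ)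
    (hα : α ≤ K * (4 * γ + μ)) (hηγ : η ≤ 3 * γ / 80) (hημ : 2048 * η ^ 2 ≤ μ ^ 2)
    (hηL : 6144 * (η * L * n) ^ 2 ≤ μ ^ 2) {S V : Fin n → ℝ} (hS : ∀ i, 0 ≤ S i)
    (hV : ∀ i, V i ≤ 4 + 8 * L ^ 2 * n * ∑ j, S j + 2 * S i)
    (hpath : ∀ i, -(2 * η) ≤ α * Λ + γ + 6 * η + 8 * η ^ 2 / μ * V i - μ / 40 * S i)
    {i : Fin n} {R : ℝ} (hR : η * R ≤ γ + 6 * η + 8 * η ^ 2 / μ * V i - μ / 40 * S i) :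
    η * R ≤ 15 * (K * γ * Λ) := by
  have hn' : (0 : ℝ) < n := by exact_mod_cast hn
  have hγ : 0 < γ := by linarith
  set P := ∑ j, S j
  have hP : 0 ≤ P := Finset.sum_nonneg fun j _ => hS j
  have hc1 : 8 * η ^ 2 / μ ≤ μ / 256 := by
    rw [div_le_iff₀ hμ]
    linarith
  have hc2 : 8 * η ^ 2 / μ * (8 * L ^ 2 * n) * n ≤ μ / 96 := by
    rw [div_mul_eq_mul_div, div_mul_eq_mul_div, div_le_iff₀ hμ]
    linarith
  have hc0 : 0 ≤ 8 * η ^ 2 / μ := by positivity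
  have hV' : ∀ j, 8 * η ^ 2 / μ * V j ≤
      μ / 64 + 8 * η ^ 2 / μ * (8 * L ^ 2 * n) * P + μ / 128 * S j := by
    intro j
    have h1 := mul_le_mul_of_nonneg_left (hV j) hc0
    have h2 := mul_le_mul_of_nonneg_right hc1 (hS j)
    linarith
  have hKγΛ : K * (γ * 0.69) ≤ K * γ * Λ := by
    rw [mul_assoc]
    gcongr
  have hγΛ : γ * 0.69 ≤ K * (γ * 0.69) := le_mul_of_one_le_left (by positivity) hK
  have hαΛ : α * Λ ≤ 6 * (K * γ * Λ) := by
    have h1 : K * (4 * γ + μ) ≤ K * (6 * γ) :=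
      mul_le_mul_of_nonneg_left (by linarith) (by linarith)
    have h2 := mul_le_mul_of_nonneg_right (hα.trans h1) (show 0 ≤ Λ by linarith)
    linarith
  -- Here `α * Λ` contributes `6`, and `γ`, `8 * η` and `μ / 64` together at most `2`, in units of
  -- `K * γ * Λ`.
  have hsum : (μ / 40 - μ / 128) * P ≤
      n * (8 * (K * γ * Λ) + 8 * η ^ 2 / μ * (8 * L ^ 2 * n) * P) := by
    calc (μ / 40 - μ / 128) * P = ∑ j, (μ / 40 - μ / 128) * S j := Finset.mul_sum _ _ _
      _ ≤ ∑ j : Fin n, (8 * (K * γ * Λ) + 8 * η ^ 2 / μ * (8 * L ^ 2 * n) * P) :=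
        Finset.sum_le_sum fun j _ => by linarith [hV' j, hpath j]
      _ = _ := by rw [Finset.sum_const, Finset.card_univ, Fintype.card_fin, nsmul_eq_mul]
  -- The cross-player term costs at most `μ / 96`, and `1/40 - 1/128 - 1/96 > 8/1200`.
  have hP' : μ * P ≤ 1200 * (n * (K * γ * Λ)) := by
    have h1 := mul_le_mul_of_nonneg_right hc2 hP
    linarith [mul_nonneg hμ.le hP]
  have hP'' : 8 * η ^ 2 / μ * (8 * L ^ 2 * n) * P ≤ 12.5 * (K * γ * Λ) := by
    refine le_of_mul_le_mul_left ?_ hn'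
    have h1 := mul_le_mul_of_nonneg_right hc2 hP
    linarith
  linarith [hV' i, mul_nonneg hμ.le (hS i)]

end Main

end COFTRL

theorem mainTheorem3 (K : ℝ) (hK : 1 ≤ K) :
    ∃ C : ℝ, 0 < C ∧
      ∀ (n d : ℕ) (U : Fin n → (Fin n → Fin d) → ℝ) (L γ μ α η : ℝ)
        (ψ : Fin n → (Fin d → ℝ) → ℝ),
        COFTRL.BoundedUtilities U →
        0 < L → L ≤ 1 → COFTRL.SmoothGame U L →
        0 < γ → 0 < μ →
        (∀ i, ContinuousOn (ψ i) (stdSimplex ℝ (Fin d))) →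
        (∀ i, COFTRL.StronglyConvexL1 μ (ψ i)) →
        (∀ i, COFTRL.IntrinsicallyLipschitz γ (ψ i)) →
        4 * γ + μ ≤ α → α ≤ K * (4 * γ + μ) →
        η ≤ COFTRL.rateCap n L γ μ → COFTRL.rateCap n L γ μ ≤ K * η →
        ∀ (T : ℕ) (x : ℕ → Fin n → Fin d → ℝ), 2 ≤ T →
          (∀ i, COFTRL.FollowsCOFTRL (ψ i) η α T
            (fun t => COFTRL.rewardVector U i (x t)) (fun t => x t i)) →
          COFTRL.IsApproxCCE U (C * (n * (γ / μ) * Real.log T / T))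
            (COFTRL.empiricalPlay x T) := by
  -- `1200 = 15 * 80`: `15` from the regret bound and `80` from the lower bound on the cap. One
  -- factor `K` comes from `α`, the other from `η`.
  refine ⟨1200 * K ^ 2, by positivity, ?_⟩
  intro n d U L γ μ α η ψ hU hL hL1 hs hγ hμ hc hsc hil hα hαK hη hηK T x hT hF
  have hx : ∀ t ∈ Finset.Icc 1 T, ∀ i, x t i ∈ stdSimplex ℝ (Fin d) := fun t ht i => by
    obtain ⟨lr, h⟩ := hF i
    exact (h t ht).2.1
  have hT0 : (0 : ℝ) < T := by positivity
  have hlog : 0.69 ≤ Real.log T := by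
    have h1 : Real.log 2 ≤ Real.log T :=
      Real.log_le_log two_pos (by exact_mod_cast hT)
    linarith [Real.log_two_gt_d9]
  refine COFTRL.isApproxCCE_of_regret_le (by omega) hx fun i a => ?_
  rw [mul_comm (T : ℝ), mul_assoc, div_mul_cancel₀ _ hT0.ne']
  have hn : 0 < n := i.pos
  -- With at most one action `μ ≤ 2 * γ` is not available, but all corrected rewards vanish.
  rcases Nat.lt_or_ge d 2 with hd | hd
  · have : Subsingleton (Fin d) := Fin.subsingleton_iff_le_one.2 (by omega)
    rw [Finset.sum_eq_zero fun t ht =>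
      COFTRL.correctedReward_eq_zero_of_subsingleton (x := fun t => x t i) (hx t ht i)]
    rw [Pi.zero_apply]
    positivity
  have hγμ := COFTRL.le_two_mul_of_regularizer hd (hil i) hγ.le (hc i) (hsc i) hμ
  have hcap := (COFTRL.le_rateCap hn hL hL1 hμ hγμ).trans hηK
  have hn' : (0 : ℝ) < n := by exact_mod_cast hn
  have hη0 : 0 < η := pos_of_mul_pos_right ((by positivity : 0 < μ / (80 * n)).trans_le hcap)
    (by linarith)
  obtain ⟨h1, h2, h3⟩ := COFTRL.rateCap_bounds hn hL hη0.le hη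
  have hν : ∀ j, ∀ t ∈ Finset.Icc 1 T, ‖COFTRL.rewardVector U j (x t)‖ ≤ 1 :=
    fun j t ht => COFTRL.norm_rewardVector_le hU (hx t ht) j
  have hreg := COFTRL.regret_le_of_path_bounds (K := K) (Λ := Real.log T) (α := α) (L := L)
    (S := fun j => ∑ t ∈ Finset.Ico 1 T, COFTRL.stepLength (fun t => x t j) t ^ 2)
    (V := fun j => ∑ t ∈ Finset.Ico 1 T,
      COFTRL.rewardChange (fun t => COFTRL.rewardVector U j (x t)) (fun t => x t j) t ^ 2)
    (i := i) (R := (∑ t ∈ Finset.Icc 1 T, COFTRL.correctedReward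
      (fun t => COFTRL.rewardVector U i (x t)) (fun t => x t i) t) a)
    hn hμ hγμ hη0 hK hlog hαK h1 h2 h3
    (fun j => Finset.sum_nonneg fun t _ => sq_nonneg _)
    (fun j => COFTRL.sum_rewardChange_sq_le hU hs hT hx j)
    (fun j => by
      have hxj := hx 1 (Finset.mem_Icc.2 ⟨le_rfl, by omega⟩) j
      -- At the rate `η / T` the `T` rounds weigh at most `2 * η` in total; any comparator strategy
      -- would do.
      have h4 := COFTRL.regret_le hμ hγ hα (hc j) (hsc j) (hil j) (by omega : 1 ≤ T) (hν j) (hF j)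
        (l := η / T) ⟨by positivity, div_le_self hη0.le (by exact_mod_cast (by omega : 1 ≤ T))⟩ hxj
      rw [div_div_cancel₀ hη0.ne'] at h4
      refine le_trans ?_ h4
      have h5 : -(2 * T : ℝ) ≤ (∑ t ∈ Finset.Icc 1 T, COFTRL.correctedReward
          (fun t => COFTRL.rewardVector U j (x t)) (fun t => x t j) t) ⬝ᵥ x 1 j := by
        rw [sum_dotProduct]
        calc -(2 * T : ℝ) = ∑ t ∈ Finset.Icc 1 T, (-2 : ℝ) := by simp; ring
          _ ≤ _ := Finset.sum_le_sum fun t ht => (abs_le.1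
            (COFTRL.abs_correctedReward_dotProduct_le ht (hν j) (fun t ht => hx t ht j) hxj)).1
      calc -(2 * η) = η / T * (-(2 * T : ℝ)) := by field_simp
        _ ≤ _ := mul_le_mul_of_nonneg_left h5 (by positivity))
    (by
      have h4 := COFTRL.regret_le hμ hγ hα (hc i) (hsc i) (hil i) (by omega : 1 ≤ T) (hν i) (hF i)
        (l := η) ⟨hη0, le_rfl⟩ (single_mem_stdSimplex ℝ a)
      rwa [div_self hη0.ne', Real.log_one, mul_zero, zero_add, dotProduct_single_one] at h4)
  refine le_of_mul_le_mul_left (hreg.trans ?_) hη0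
  have h6 : 1 ≤ 80 * n / μ * (K * η) := by
    have := mul_le_mul_of_nonneg_left hcap (show 0 ≤ 80 * n / μ by positivity)
    rwa [div_mul_div_cancel₀ hμ.ne', div_self (by positivity)] at this
  have h7 := mul_le_mul_of_nonneg_left h6
    (show 0 ≤ 15 * (K * γ * Real.log T) by positivity)
  calc 15 * (K * γ * Real.log T) ≤
        15 * (K * γ * Real.log T) * (80 * n / μ * (K * η)) := by linarith
    _ = η * (1200 * K ^ 2 * (n * (γ / μ) * Real.log T)) := by ring
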